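/- **Conventions.** An *ind-space* is a set $X$ with an increasing filtration $X_1\subseteq X_2\subseteq\cdots$, $X=\bigcup_n X_n$, where each $X_n$ is a topological space and is a closed subspace of $X_{n+1}$; $X$ carries the direct limit topology (a subset of $X$ is closed if and only if its intersection with each $X_n$ is closed in $X_n$). For $S\subseteq X$ put $S_n=S\cap X_n$. A *$\mathbb C^\times$-action* on the ind-space $X$ is a continuous action of $\mathbb C^\times$ on $X$ under which each $X_n$ is invariant. For $W\subseteq X$ open and $C\subseteq X$ any subset, $C$ *flows to $W$ at zero* if for every $n$ there is $s>0$ such that $t\cdot C_n\subseteq W_n$ for all $t\in\mathbb C^\times$ with $|t|\le s$. A closed $\mathbb C^\times$-invariant ind-subspace $A\subseteq X$ is *strongly attractive* if for every open neighborhood $W$ of $A$ and every $x\in X$ there is a neighborhood $U$ of $x$ that flows to $W$ at zero. A subspace $B$ of a space $Y$ is a *deformation retract* of $Y$ if there is a homotopy $f_\tau\colon Y\to Y$, $0\le\tau\le1$, with $f_0=\mathrm{id}_Y$, $f_1(Y)\subseteq B$ and $f_\tau(b)=b$ for all $b\in B$ and all $\tau$. A *regular neighborhood* of $B$ in $Y$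 is a neighborhood $W$ of $B$ in $Y$ such that $B$ is a deformation retract of $W$. A *weak equivalence* is a continuous map inducing a bijection on path components and isomorphisms on all homotopy groups $\pi_n$, $n\ge1$, for every choice of base point. The pair $(X,A)$ is an *ind-CW pair* if each $X_n$ admits a CW structure such that $X_{n-1}$ (when $n>1$) and $A_n$ are subcomplexes; the structures for different $n$ need not be compatible. **Theorem 3.4.** Let $X$ be a $T_1$ ind-space (points are closed) with a $\mathbb C^\times$-action, and let $A\subseteq X$ be a strongly attractive closed invariant ind-subspace such that, for each $n$, $A_n$ has a regular neighborhood in $X_n$. Then the inclusion $A\to X$ is a weak equivalence. If moreover $(X,A)$ is an ind-CW pair, then $A$ is a deformation retract of $X$. -/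

import Mathlib

open Set Topology unitInterval

universe u v

/-! ### Ind-spaces -/

/-- An ind-space structure on the space `X`: an increasing sequence of subsets `piece n` with union
`X`, each closed in the next, such that `X` has the direct limit topology, that is, a subset of `X`
is closed as soon as its intersection with each `piece n` is closed in `piece n`.
Each `piece n` has the subspace topology.  (If topological spaces `X₀ ⊆ X₁ ⊆ ⋯` are given, each a
closed subspace of the next, then their union with the direct limit topology induces on each `Xₙ`
its given topology, so nothing is lost by starting from the topology of `X`.) -/
structure IndSpace (X : Type u) [TopologicalSpace X] where
  piece : ℕ → Set X
  piece_subset_succ : ∀ n, piece n ⊆ piece (n + 1)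
  iUnion_piece : ⋃ n, piece n = univ
  isClosed_piece_succ : ∀ n, IsClosed ((↑) ⁻¹' piece n : Set (piece (n + 1)))
  isClosed_of_forall : ∀ S : Set X, (∀ n, IsClosed ((↑) ⁻¹' S : Set (piece n))) → IsClosed S

/-! ### Deformation retracts and regular neighborhoods -/

/-- `B` is a deformation retract of the space `Y`: there is a homotopy, stationary on `B`, from the
identity of `Y` to a map with image in `B`. -/
def IsDeformationRetract {Y : Type u} [TopologicalSpace Y] (B : Set Y) : Prop :=
  ∃ r : C(Y, Y), (∀ y, r y ∈ B) ∧ (ContinuousMap.id Y).HomotopicRel r B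

/-- `B` has a regular neighborhood in `Y`: a neighborhood of which it is a deformation retract. -/
def HasRegularNeighborhood {Y : Type u} [TopologicalSpace Y] (B : Set Y) : Prop :=
  ∃ W ∈ 𝓝ˢ B, IsDeformationRetract ((↑) ⁻¹' B : Set W)

/-! ### Weak equivalences -/

section WeakEquivalence

variable {X : Type u} {Y : Type v} [TopologicalSpace X] [TopologicalSpace Y]

/-- The map on sets of path components induced by a continuous map. -/
def zerothHomotopyMap (f : C(X, Y)) : ZerothHomotopy X → ZerothHomotopy Y :=
  Quotient.map f fun _ _ h => h.map f.continuous

/-- Composition of a generalized loop with a continuous map. -/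
def genLoopMap {N : Type} (f : C(X, Y)) (x : X) (p : GenLoop N X x) : GenLoop N Y (f x) :=
  ⟨f.comp p.1, fun y hy => congrArg f (p.2 y hy)⟩

/-- The homomorphism induced by a continuous map on the homotopy groups of dimension `n + 1`. -/
noncomputable def homotopyGroupMap (f : C(X, Y)) (n : ℕ) (x : X) :
    HomotopyGroup.Pi (n + 1) X x →* HomotopyGroup.Pi (n + 1) Y (f x) :=
  MonoidHom.mk'
    (Quotient.map (genLoopMap f x) fun _ _ h => h.comp_continuousMap f) (by
      intro a b
      induction a using Quotient.inductionOn with | _ p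
      induction b using Quotient.inductionOn with | _ q
      have h1 := HomotopyGroup.mul_spec (i := (0 : Fin (n + 1))) (p := p) (q := q)
      have h2 := HomotopyGroup.mul_spec (i := (0 : Fin (n + 1)))
        (p := genLoopMap f x p) (q := genLoopMap f x q)
      have h3 : genLoopMap f x (GenLoop.transAt 0 q p) =
          GenLoop.transAt 0 (genLoopMap f x q) (genLoopMap f x p) := by
        ext t
        exact apply_ite f _ _ _
      refine (congrArg _ h1).trans (Eq.trans ?_ h2.symm)
      exact congrArg (Quotient.mk _) h3)

/-- A weak equivalence: a map inducing a bijection on path components and isomorphisms on all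
homotopy groups, for every choice of base point. -/
def IsWeakEquivalence (f : C(X, Y)) : Prop :=
  Function.Bijective (zerothHomotopyMap f) ∧
    ∀ (n : ℕ) (x : X), Function.Bijective (homotopyGroupMap f n x)

end WeakEquivalence

namespace IndSpace

variable {X : Type u} [TopologicalSpace X]

/-! ### Complex flows -/

/-- `C` flows to `W` at zero: for every `n` there is `s > 0` such that `t • Cₙ ⊆ Wₙ` whenever
`|t| ≤ s`, where `Cₙ = C ∩ Xₙ` and `Wₙ = W ∩ Xₙ`. -/
def FlowsToAtZero (F : IndSpace X) [MulAction ℂˣ X] (C W : Set X) : Prop :=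
  ∀ n, ∃ s : ℝ, 0 < s ∧ ∀ t : ℂˣ, ‖(t : ℂ)‖ ≤ s →
    ∀ x ∈ C ∩ F.piece n, t • x ∈ W ∩ F.piece n

/-- `A` is a strongly attractive closed invariant ind-subspace: it is closed, invariant, and for
every open neighborhood `W` of `A`, each point has a neighborhood that flows to `W` at zero. -/
structure IsStronglyAttractive (F : IndSpace X) [MulAction ℂˣ X] (A : Set X) : Prop where
  isClosed : IsClosed A
  smul_mem : ∀ (t : ℂˣ), ∀ x ∈ A, t • x ∈ A
  flowsTo : ∀ W : Set X, IsOpen W → A ⊆ W → ∀ x : X, ∃ U ∈ 𝓝 x, F.FlowsToAtZero U W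

/-! ### Ind-CW pairs -/

/-- `(X, A)` is an ind-CW pair: each `Xₙ` is a Hausdorff space which admits a CW structure having
`Aₙ = A ∩ Xₙ` and (for a filtrant that is not the first) the preceding filtrant as subcomplexes.
The CW structures for different `n` need not be compatible. -/
def IsIndCWPair (F : IndSpace X) (A : Set X) : Prop :=
  (∀ n, T2Space (F.piece n)) ∧
  (∃ (_ : CWComplex (univ : Set (F.piece 0)))
      (E : RelCWComplex.Subcomplex (univ : Set (F.piece 0))),
      (E : Set (F.piece 0)) = (↑) ⁻¹' A) ∧
  ∀ n, ∃ (_ : CWComplex (univ : Set (F.piece (n + 1))))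
      (E E' : RelCWComplex.Subcomplex (univ : Set (F.piece (n + 1)))),
      (E : Set (F.piece (n + 1))) = (↑) ⁻¹' A ∧
      (E' : Set (F.piece (n + 1))) = (↑) ⁻¹' F.piece n

end IndSpace

/-! The key property is `DeformsCompactsInto`. A compact set in a T₁ ind-space lies in one piece Xₙ;
strong attraction and compactness give one small scalar that moves it into a regular neighborhood of
Aₙ, whose retraction then carries it into A. Both stages keep points of A inside A. The flow,
however, may move points within A, so this homotopy is not relative to A.

The defect is repaired by `DeformsCompactsInto.exists_extension`. Let P be the space of paths in X
that end in A, with p : P → X the starting point. A map on a disk, with a lift to P over its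
boundary sphere, is enlarged by a collar running along the given paths; the outer boundary then lies
in A and stays there under the deformation of the enlarged disk. Hence p has the right lifting
property for spheres in disks.

Lifting with constant paths on the boundary compresses cubes relative to their boundaries, which
gives the weak equivalence. For an ind-CW pair, the section of p by constant paths over A extends
cell by cell and piece by piece to all of X, and such a section is a deformation retraction. Passing
to the next piece uses only continuity of the section on the previous one, so the CW structures need
not be compatible. -/

open Metric

/-! ### Deforming compact families into a subset -/

section Deformation

variable {X : Type u} [TopologicalSpace X]

/-- Every map from a compact space to `X` can be deformed into `A`, through maps which keep
inside `A` the points that start there. -/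
def DeformsCompactsInto (A : Set X) : Prop :=
  ∀ (K : Type) [TopologicalSpace K] [CompactSpace K] (f : C(K, X)),
    ∃ g : C(K, X), (∀ k, g k ∈ A) ∧ f.HomotopicWith g fun h => MapsTo h (f ⁻¹' A) A

/-- The point `(1 - τ) x + τ y`, where `y = 2 x / max ‖x‖ (1 / 2)` is obtained from `x` by radially
stretching the ball of radius one half onto that of radius two, and projecting all points outside
the former onto the sphere of radius two. -/
noncomputable def stretch {E : Type*} [NormedAddCommGroup E] [NormedSpace ℝ E] (x : E) (τ : ℝ) :
    E :=
  (1 - τ + τ * (2 / max ‖x‖ (1 / 2))) • x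

/-- The height in `[0, 1]` accompanying `stretch`. -/
noncomputable def stretchHeight {E : Type*} [NormedAddCommGroup E] (x : E) (τ : ℝ) : ℝ :=
  τ * min 1 (2 - 2 * ‖x‖)

/-! ### Paths in the cylinder from the bottom to the top or the side -/

section Stretch

variable {E : Type*} [NormedAddCommGroup E]

lemma continuous_stretchHeight : Continuous fun p : E × ℝ => stretchHeight p.1 p.2 := by
  unfold stretchHeight
  fun_prop

lemma stretchHeight_mem {x : E} {τ : ℝ} (hx : ‖x‖ ≤ 1) (hτ : τ ∈ I) : stretchHeight x τ ∈ I := by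
  have h0 : 0 ≤ min 1 (2 - 2 * ‖x‖) := le_min (by norm_num) (by linarith)
  exact ⟨mul_nonneg hτ.1 h0, mul_le_one₀ hτ.2 h0 (min_le_left _ _)⟩

@[simp] lemma stretchHeight_zero (x : E) : stretchHeight x 0 = 0 := by simp [stretchHeight]

lemma stretchHeight_of_norm_eq_one {x : E} (hx : ‖x‖ = 1) (τ : ℝ) : stretchHeight x τ = 0 := by
  simp [stretchHeight, hx]

variable [NormedSpace ℝ E]

lemma continuous_stretch : Continuous fun p : E × ℝ => stretch p.1 p.2 := by
  unfold stretch
  have : ∀ p : E × ℝ, max ‖p.1‖ (1 / 2) ≠ 0 := fun p => (lt_max_of_lt_right (by norm_num)).ne'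
  fun_prop (disch := exact this _)

lemma norm_stretch_le {x : E} {τ : ℝ} (hx : ‖x‖ ≤ 1) (hτ : τ ∈ I) : ‖stretch x τ‖ ≤ 2 := by
  have hm : 0 < max ‖x‖ (1 / 2) := lt_max_of_lt_right (by norm_num)
  have h0 : 0 ≤ 1 - τ := by linarith [hτ.2]
  rw [stretch, norm_smul, Real.norm_of_nonneg (by have := hτ.1; positivity)]
  have h1 : 2 / max ‖x‖ (1 / 2) * ‖x‖ ≤ 2 := by
    rw [div_mul_eq_mul_div, div_le_iff₀ hm]
    gcongr
    exact le_max_left _ _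
  nlinarith [hτ.1, hτ.2]

@[simp] lemma stretch_zero (x : E) : stretch x 0 = x := by simp [stretch]

/-- Boundary points cross the collar radially at unit speed, so there the new path is exactly the
prescribed one. -/
lemma stretch_of_norm_eq_one {x : E} (hx : ‖x‖ = 1) (τ : ℝ) : stretch x τ = (1 + τ) • x := by
  rw [stretch, hx, max_eq_left (by norm_num)]
  congr 1
  ring

/-- Every path ends on the side or the top of the cylinder, the two places where the deformation of
the enlarged ball takes values in A. -/
lemma norm_stretch_one_or (x : E) : ‖stretch x 1‖ = 2 ∨ stretchHeight x 1 = 1 := by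
  rcases le_total (1 / 2) ‖x‖ with h | h
  · left
    have : 0 < ‖x‖ := by linarith
    rw [stretch, max_eq_left h, norm_smul, Real.norm_of_nonneg (by simp; positivity)]
    field_simp
    ring
  · right
    rw [stretchHeight, min_eq_left (by linarith), one_mul]

end Stretch

/-! ### The collar and the extension of paths over a ball -/

variable {E : Type} [NormedAddCommGroup E] [NormedSpace ℝ E]

/-- A map on the unit ball, together with a family of paths on the sphere starting at its values,
as a map on the ball of radius two. -/
noncomputable def collar (f : E → X) (l : E → C(I, X)) (x : E) : X :=
  open scoped Classical in
  if ‖x‖ ≤ 1 then f x else l (‖x‖⁻¹ • x) (projIcc 0 1 zero_le_one (‖x‖ - 1))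

lemma continuous_collar {f : E → X} {l : E → C(I, X)} (hf : ContinuousOn f (closedBall 0 1))
    (hl : ContinuousOn l (sphere 0 1)) (hlf : ∀ x ∈ sphere (0 : E) 1, l x 0 = f x) :
    Continuous (collar f l) := by
  have h1 : closure {x : E | ‖x‖ ≤ 1} ⊆ closedBall 0 1 := by
    rw [(isClosed_le continuous_norm continuous_const).closure_eq]
    intro x hx; simpa using hx
  have h2 : closure {x : E | ¬ ‖x‖ ≤ 1} ⊆ {x | 1 ≤ ‖x‖} :=
    closure_minimal (fun x hx => (not_le.1 hx).le) (isClosed_le continuous_const continuous_norm)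
  refine continuous_if ?_ (hf.mono h1) ?_
  · intro x hx
    have hx1 : ‖x‖ = 1 := frontier_le_subset_eq continuous_norm continuous_const hx
    simp [hx1, hlf x (by simpa using hx1)]
  · refine ContinuousOn.mono ?_ h2
    have h3 : ContinuousOn (fun x : E => l (‖x‖⁻¹ • x)) {x | 1 ≤ ‖x‖} := by
      refine hl.comp ?_ ?_
      · refine ContinuousOn.smul (continuous_norm.continuousOn.inv₀ ?_) continuousOn_id
        intro x hx
        have : (1 : ℝ) ≤ ‖x‖ := hx
        positivity
      · intro x hx
        have : (1 : ℝ) ≤ ‖x‖ := hx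
        have h : 0 < ‖x‖ := by positivity
        simp [norm_smul, h.ne']
    have h4 : Continuous fun x : E => projIcc (0 : ℝ) 1 zero_le_one (‖x‖ - 1) :=
      continuous_projIcc.comp (by fun_prop)
    exact (continuous_eval (F := C(I, X))).comp_continuousOn (h3.prodMk h4.continuousOn)

lemma collar_of_norm_le {f : E → X} {l : E → C(I, X)} {x : E} (hx : ‖x‖ ≤ 1) :
    collar f l x = f x :=
  if_pos hx

lemma collar_smul {f : E → X} {l : E → C(I, X)} (hlf : ∀ x ∈ sphere (0 : E) 1, l x 0 = f x) {x : E}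
    (hx : ‖x‖ = 1) (τ : I) : collar f l ((1 + (τ : ℝ)) • x) = l x τ := by
  have h0 : ‖(1 + (τ : ℝ)) • x‖ = 1 + τ := by
    rw [norm_smul, hx, mul_one, Real.norm_of_nonneg]
    linarith [τ.2.1]
  by_cases hτ : (τ : ℝ) ≤ 0
  · have : τ = 0 := le_antisymm hτ τ.2.1
    subst this
    rw [collar_of_norm_le (by simp [hx]), hlf x (by simpa using hx)]
    simp
  · have h1 : (1 + (τ : ℝ)) ≠ 0 := by linarith
    rw [collar, if_neg (by rw [h0]; linarith), h0, smul_smul, inv_mul_cancel₀ h1, one_smul,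
      add_sub_cancel_left, projIcc_val]

/-- Extension of a family of paths ending in `A` from the sphere to the ball. -/
lemma DeformsCompactsInto.exists_extension [ProperSpace E] {A : Set X} (hA : DeformsCompactsInto A)
    {f : E → X} {l : E → C(I, X)} (hf : ContinuousOn f (closedBall 0 1))
    (hl : ContinuousOn l (sphere 0 1))
    (hlf : ∀ x ∈ sphere (0 : E) 1, l x 0 = f x ∧ l x 1 ∈ A) :
    ∃ L : E → C(I, X), ContinuousOn L (closedBall 0 1) ∧ EqOn L l (sphere 0 1) ∧
      ∀ x ∈ closedBall (0 : E) 1, L x 0 = f x ∧ L x 1 ∈ A := by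
  classical
  have hlf0 : ∀ x ∈ sphere (0 : E) 1, l x 0 = f x := fun x hx => (hlf x hx).1
  have : CompactSpace (closedBall (0 : E) 2) := 
    isCompact_iff_compactSpace.1 (isCompact_closedBall _ _)
  let c : C(closedBall (0 : E) 2, X) :=
    ⟨fun x => collar f l x, (continuous_collar hf hl hlf0).comp continuous_subtype_val⟩
  obtain ⟨g, hg, ⟨G⟩⟩ := hA _ c
  -- The outer end of the collar is the endpoint of a prescribed path.
  have hc : ∀ x : closedBall (0 : E) 2, ‖(x : E)‖ = 2 → c x ∈ A := by
    intro x hx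
    have h1 : ‖(2⁻¹ : ℝ) • (x : E)‖ = 1 := by rw [norm_smul, hx]; norm_num
    have h2 := collar_smul hlf0 h1 1
    rw [smul_smul, show (1 + ((1 : I) : ℝ)) * 2⁻¹ = 1 by norm_num, one_smul] at h2
    change collar f l x ∈ A
    rw [h2]
    exact (hlf _ (by simpa using h1)).2
  have hG : ∀ (t : I) (x : closedBall (0 : E) 2), ‖(x : E)‖ = 2 → G (t, x) ∈ A :=
    fun t x hx => G.prop' t (hc x hx)
  -- For fixed x, this is a path in the cylinder from (0, x) to its top or side; composing with G
  -- gives the required path in X.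
  let Φ : closedBall (0 : E) 1 × I → I × closedBall (0 : E) 2 := fun p =>
    (⟨stretchHeight (p.1 : E) p.2, stretchHeight_mem (mem_closedBall_zero_iff.1 p.1.2) p.2.2⟩,
      ⟨stretch (p.1 : E) p.2, by simpa using norm_stretch_le (mem_closedBall_zero_iff.1 p.1.2) p.2.2⟩)
  have hi : Continuous fun p : closedBall (0 : E) 1 × I => ((p.1 : E), (p.2 : ℝ)) := by fun_prop
  have hΦ : Continuous Φ :=
    ((continuous_stretchHeight.comp hi).subtype_mk _).prodMk
      ((continuous_stretch.comp hi).subtype_mk _)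
  let L : C(closedBall (0 : E) 1, C(I, X)) :=
    ContinuousMap.curry ⟨fun p => G (Φ p), G.continuous.comp hΦ⟩
  have hL : ∀ x τ, L x τ = G (Φ (x, τ)) := fun _ _ => rfl
  refine ⟨fun x => if h : x ∈ closedBall (0 : E) 1 then L ⟨x, h⟩ else L ⟨0, by simp⟩, ?_, ?_, ?_⟩
  · rw [continuousOn_iff_continuous_domRestrict]
    convert L.continuous using 1
    ext1 x
    simp only [domRestrict_apply]
    rw [dif_pos x.2]
  · intro x hx
    have hx1 : ‖x‖ = 1 := by simpa using hx
    have hx' : x ∈ closedBall (0 : E) 1 := sphere_subset_closedBall hx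
    ext τ
    simp only [dif_pos hx', hL]
    have : Φ (⟨x, hx'⟩, τ) = (0, ⟨(1 + (τ : ℝ)) • x, by
        have := τ.2.2
        have h0 := τ.2.1
        rw [mem_closedBall_zero_iff, norm_smul, hx1, mul_one, Real.norm_of_nonneg] <;> linarith⟩) :=
      Prod.ext (Subtype.ext (stretchHeight_of_norm_eq_one hx1 _))
        (Subtype.ext (stretch_of_norm_eq_one hx1 _))
    rw [this, G.apply_zero]
    exact collar_smul hlf0 hx1 τ
  · intro x hx
    simp only [dif_pos hx, hL]
    constructor
    · have : Φ (⟨x, hx⟩, 0) = (0, ⟨x, closedBall_subset_closedBall (by norm_num) hx⟩) :=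
        Prod.ext (Subtype.ext (stretchHeight_zero _)) (Subtype.ext (stretch_zero _))
      rw [this, G.apply_zero]
      exact collar_of_norm_le (by simpa using hx)
    · rcases norm_stretch_one_or x with h | h
      · exact hG _ _ h
      · have : (Φ (⟨x, hx⟩, 1)).1 = 1 := Subtype.ext h
        rw [show Φ (⟨x, hx⟩, 1) = (1, (Φ (⟨x, hx⟩, 1)).2) from Prod.ext this rfl, G.apply_one]
        exact hg _

end Deformation

/-! ### Weak equivalences from deformations of compact families -/

section Cubes

variable {X : Type u} [TopologicalSpace X] {A : Set X}

/-- A pair homeomorphic, compatibly with the boundary, to the unit ball of a normed space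
has the compression property relative to any subset into which compacts deform. -/
lemma DeformsCompactsInto.exists_compression (hA : DeformsCompactsInto A) {E : Type}
    [NormedAddCommGroup E] [NormedSpace ℝ E] [ProperSpace E] {K : Type} [TopologicalSpace K]
    {S : Set K} (i : C(K, E)) (r : C(E, K)) (hri : ∀ k, r (i k) = k)
    (hi : ∀ k, i k ∈ closedBall (0 : E) 1) (hiS : MapsTo i S (sphere 0 1))
    (hrS : MapsTo r (sphere 0 1) S) (f : C(K, X)) (hf : MapsTo f S A) :
    ∃ H : C(K, C(I, X)), (∀ k, H k 0 = f k) ∧ (∀ k, H k 1 ∈ A) ∧ ∀ k ∈ S, ∀ t, H k t = f k := by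
  -- Constant paths on the sphere make the compression stationary on S.
  obtain ⟨L, hL, hLS, hLf⟩ := hA.exists_extension (f := f ∘ r)
    (l := fun x => ContinuousMap.const I (f (r x)))
    (f.continuous.comp r.continuous).continuousOn
    ((ContinuousMap.continuous_const'.comp (f.continuous.comp r.continuous)).continuousOn)
    (fun x hx => ⟨rfl, hf (hrS hx)⟩)
  refine ⟨⟨fun k => L (i k), hL.comp_continuous i.continuous hi⟩, fun k => ?_, fun k => ?_,
    fun k hk t => ?_⟩
  · have := (hLf _ (hi k)).1
    simpa [hri] using this
  · exact (hLf _ (hi k)).2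
  · have := hLS (hiS hk)
    simp [this, hri]

/-- The affine homeomorphism from the unit interval onto `[-1, 1]`. -/
def unitIntervalToReal (t : I) : ℝ := 2 * t - 1

/-- The affine homeomorphism from `[-1, 1]` onto the unit interval, extended to the line. -/
noncomputable def realToUnitInterval (x : ℝ) : I := projIcc 0 1 zero_le_one ((1 + x) / 2)

lemma continuous_unitIntervalToReal : Continuous unitIntervalToReal := by
  unfold unitIntervalToReal; fun_prop

lemma continuous_realToUnitInterval : Continuous realToUnitInterval :=
  continuous_projIcc.comp (by fun_prop)

lemma realToUnitInterval_unitIntervalToReal (t : I) :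
    realToUnitInterval (unitIntervalToReal t) = t := by
  have : (1 + unitIntervalToReal t) / 2 = t := by unfold unitIntervalToReal; ring
  rw [realToUnitInterval, this, projIcc_val]

lemma norm_unitIntervalToReal_le (t : I) : ‖unitIntervalToReal t‖ ≤ 1 := by
  rw [Real.norm_eq_abs, abs_le, unitIntervalToReal]
  constructor <;> linarith [t.2.1, t.2.2]

lemma norm_unitIntervalToReal_eq {t : I} (ht : t = 0 ∨ t = 1) : ‖unitIntervalToReal t‖ = 1 := by
  rcases ht with rfl | rfl <;> norm_num [unitIntervalToReal]

lemma realToUnitInterval_eq {x : ℝ} (hx : ‖x‖ = 1) :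
    realToUnitInterval x = 0 ∨ realToUnitInterval x = 1 := by
  rcases (abs_eq zero_le_one).1 hx with rfl | rfl
  · right; norm_num [realToUnitInterval]
  · left; norm_num [realToUnitInterval]

variable {N : Type} [Fintype N]

lemma exists_norm_eq_one_of_mem_sphere {x : N → ℝ} (hx : ‖x‖ = 1) : ∃ j, ‖x j‖ = 1 := by
  by_contra! h
  have : ‖x‖ < 1 := (pi_norm_lt_iff one_pos).2 fun j =>
    lt_of_le_of_ne (hx ▸ norm_le_pi_norm x j) (h j)
  linarith

lemma norm_cube_le (y : N → I) : ‖fun j => unitIntervalToReal (y j)‖ ≤ 1 :=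
  (pi_norm_le_iff_of_nonneg zero_le_one).2 fun _ => norm_unitIntervalToReal_le _

lemma norm_cube_eq {y : N → I} (hy : y ∈ Cube.boundary N) :
    ‖fun j => unitIntervalToReal (y j)‖ = 1 := by
  obtain ⟨j, hj⟩ := hy
  refine le_antisymm (norm_cube_le y) ?_
  rw [← norm_unitIntervalToReal_eq hj]
  exact norm_le_pi_norm (fun j => unitIntervalToReal (y j)) j

lemma cube_mem_boundary {x : N → ℝ} (hx : ‖x‖ = 1) :
    (fun j => realToUnitInterval (x j)) ∈ Cube.boundary N := by
  obtain ⟨j, hj⟩ := exists_norm_eq_one_of_mem_sphere hx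
  exact ⟨j, realToUnitInterval_eq hj⟩

/-- Compression of a cube relative to its boundary. -/
lemma DeformsCompactsInto.exists_compression_cube (hA : DeformsCompactsInto A) (f : C(N → I, X))
    (hf : MapsTo f (Cube.boundary N) A) :
    ∃ H : C(N → I, C(I, X)), (∀ k, H k 0 = f k) ∧ (∀ k, H k 1 ∈ A) ∧
      ∀ k ∈ Cube.boundary N, ∀ t, H k t = f k :=
  hA.exists_compression (E := N → ℝ) (K := N → I) (S := Cube.boundary N)
    ⟨fun y j => unitIntervalToReal (y j),
      continuous_pi fun j => continuous_unitIntervalToReal.comp (continuous_apply j)⟩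
    ⟨fun x j => realToUnitInterval (x j),
      continuous_pi fun j => continuous_realToUnitInterval.comp (continuous_apply j)⟩
    (fun _ => funext fun _ => realToUnitInterval_unitIntervalToReal _)
    (fun _ => mem_closedBall_zero_iff.2 (norm_cube_le _))
    (fun _ hy => mem_sphere_zero_iff_norm.2 (norm_cube_eq hy))
    (fun _ hx => cube_mem_boundary (mem_sphere_zero_iff_norm.1 hx)) f hf

/-- Compression of the product of an interval and a cube relative to its boundary. -/
lemma DeformsCompactsInto.exists_compression_prod_cube (hA : DeformsCompactsInto A)
    (f : C(I × (N → I), X)) (hf0 : ∀ y, f (0, y) ∈ A) (hf1 : ∀ y, f (1, y) ∈ A)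
    (hf : ∀ t, ∀ y ∈ Cube.boundary N, f (t, y) ∈ A) :
    ∃ g : C(I × (N → I), A), (∀ y, (g (0, y) : X) = f (0, y)) ∧ (∀ y, (g (1, y) : X) = f (1, y)) ∧
      ∀ t, ∀ y ∈ Cube.boundary N, (g (t, y) : X) = f (t, y) := by
  obtain ⟨H, -, H1, HS⟩ := hA.exists_compression (E := ℝ × (N → ℝ)) (K := I × (N → I))
    (S := {p | (p.1 = 0 ∨ p.1 = 1) ∨ p.2 ∈ Cube.boundary N})
    ⟨fun p => (unitIntervalToReal p.1, fun j => unitIntervalToReal (p.2 j)),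
      (continuous_unitIntervalToReal.comp continuous_fst).prodMk (continuous_pi fun j =>
        continuous_unitIntervalToReal.comp ((continuous_apply j).comp continuous_snd))⟩
    ⟨fun p => (realToUnitInterval p.1, fun j => realToUnitInterval (p.2 j)),
      (continuous_realToUnitInterval.comp continuous_fst).prodMk (continuous_pi fun j =>
        continuous_realToUnitInterval.comp ((continuous_apply j).comp continuous_snd))⟩
    (fun _ => Prod.ext (realToUnitInterval_unitIntervalToReal _)
      (funext fun _ => realToUnitInterval_unitIntervalToReal _))
    (fun _ => mem_closedBall_zero_iff.2
      (norm_prod_le_iff.2 ⟨norm_unitIntervalToReal_le _, norm_cube_le _⟩))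
    (by
      rintro ⟨t, y⟩ hp
      rw [mem_sphere_zero_iff_norm]
      change max ‖unitIntervalToReal t‖ ‖fun j => unitIntervalToReal (y j)‖ = 1
      rcases hp with ht | hy
      · rw [norm_unitIntervalToReal_eq ht, max_eq_left (norm_cube_le y)]
      · rw [norm_cube_eq hy, max_eq_right (norm_unitIntervalToReal_le t)])
    (by
      rintro ⟨s, x⟩ hp
      rw [mem_sphere_zero_iff_norm, Prod.norm_mk] at hp
      rcases max_choice ‖s‖ ‖x‖ with h | h
      · exact Or.inl (realToUnitInterval_eq (h.symm.trans hp))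
      · exact Or.inr (cube_mem_boundary (h.symm.trans hp)))
    f (by
      rintro ⟨t, y⟩ ((rfl | rfl) | hy)
      exacts [hf0 y, hf1 y, hf t y hy])
  exact ⟨⟨fun p => ⟨H p 1, H1 p⟩,
      ((continuous_eval_const (F := C(I, X)) 1).comp H.continuous).subtype_mk _⟩,
    fun y => HS (0, y) (Or.inl (Or.inl rfl)) 1, fun y => HS (1, y) (Or.inl (Or.inr rfl)) 1,
    fun t y hy => HS (t, y) (Or.inr hy) 1⟩

end Cubes

/-! ### Path components and homotopy groups -/

section WeakEquivalence

variable {X : Type u} [TopologicalSpace X] {A : Set X}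

lemma DeformsCompactsInto.bijective_zerothHomotopyMap (hA : DeformsCompactsInto A) :
    Function.Bijective
      (zerothHomotopyMap (⟨Subtype.val, continuous_subtype_val⟩ : C(A, X))) := by
  constructor
  · intro a b
    induction a using Quotient.inductionOn with | _ a
    induction b using Quotient.inductionOn with | _ b
    intro h
    obtain ⟨γ⟩ : Joined (a : X) b := Quotient.exact h
    -- A path is a homotopy of the zero-dimensional cube, whose boundary is empty.
    obtain ⟨g, g0, g1, -⟩ := hA.exists_compression_prod_cube (N := Fin 0)
      ⟨fun p => γ p.1, γ.continuous.comp continuous_fst⟩ (fun _ => by simp) (fun _ => by simp)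
      (fun _ _ ⟨j, _⟩ => j.elim0)
    refine Quotient.sound ⟨⟨⟨fun t => g (t, 0), by fun_prop⟩, ?_, ?_⟩⟩
    · exact Subtype.ext ((g0 0).trans γ.source)
    · exact Subtype.ext ((g1 0).trans γ.target)
  · intro x
    induction x using Quotient.inductionOn with | _ x
    obtain ⟨g, hg, ⟨G⟩⟩ := hA PUnit (ContinuousMap.const _ x)
    refine ⟨Quotient.mk _ ⟨g PUnit.unit, hg _⟩, Quotient.sound (Joined.symm ?_)⟩
    exact ⟨⟨⟨fun t => G (t, PUnit.unit), by fun_prop⟩, G.apply_zero _, G.apply_one _⟩⟩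

lemma DeformsCompactsInto.bijective_homotopyGroupMap (hA : DeformsCompactsInto A) (n : ℕ) (a : A) :
    Function.Bijective
      (homotopyGroupMap (⟨Subtype.val, continuous_subtype_val⟩ : C(A, X)) n a) := by
  constructor
  · intro p q
    induction p using Quotient.inductionOn with | _ p
    induction q using Quotient.inductionOn with | _ q
    intro h
    obtain ⟨h⟩ : GenLoop.Homotopic
        (genLoopMap (⟨Subtype.val, continuous_subtype_val⟩ : C(A, X)) a p)
        (genLoopMap (⟨Subtype.val, continuous_subtype_val⟩ : C(A, X)) a q) := Quotient.exact h
    have h0 : ∀ y, h (0, y) = (p y : X) := fun y => h.apply_zero y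
    have h1 : ∀ y, h (1, y) = (q y : X) := fun y => h.apply_one y
    have hS : ∀ t, ∀ y ∈ Cube.boundary (Fin (n + 1)), h (t, y) = (p y : X) :=
      fun t y hy => h.eq_fst t hy
    obtain ⟨g, g0, g1, gS⟩ := hA.exists_compression_prod_cube ⟨h, h.continuous⟩
      (fun y => (h0 y).symm ▸ (p y).2) (fun y => (h1 y).symm ▸ (q y).2)
      (fun t y hy => (hS t y hy).symm ▸ (p y).2)
    refine Quotient.sound ⟨⟨⟨g, fun y => ?_, fun y => ?_⟩, fun t y hy => ?_⟩⟩
    · exact Subtype.ext ((g0 y).trans (h0 y))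
    · exact Subtype.ext ((g1 y).trans (h1 y))
    · exact Subtype.ext ((gS t y hy).trans (hS t y hy))
  · intro p
    induction p using Quotient.inductionOn with | _ p
    have hp : ∀ y ∈ Cube.boundary (Fin (n + 1)), p y = a := p.2
    obtain ⟨H, H0, H1, HS⟩ := hA.exists_compression_cube p.1
      (fun y hy => by rw [GenLoop.coe_coe, hp y hy]; exact a.2)
    refine ⟨Quotient.mk _ ⟨⟨fun y => ⟨H y 1, H1 y⟩, ?_⟩, fun y hy => ?_⟩,
      Quotient.sound (GenLoop.Homotopic.symm ?_)⟩
    · exact ((continuous_eval_const (F := C(I, X)) 1).comp H.continuous).subtype_mk _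
    · exact Subtype.ext ((HS y hy 1).trans (hp y hy))
    · exact ⟨⟨⟨⟨fun q => H q.2 q.1, by fun_prop⟩, H0, fun y => rfl⟩, fun t y hy => HS y hy t⟩⟩

lemma DeformsCompactsInto.isWeakEquivalence (hA : DeformsCompactsInto A) :
    IsWeakEquivalence (⟨Subtype.val, continuous_subtype_val⟩ : C(A, X)) :=
  ⟨hA.bijective_zerothHomotopyMap, hA.bijective_homotopyGroupMap⟩

end WeakEquivalence

/-! ### Topology of ind-spaces, and the flow on compact sets -/

namespace IndSpace

variable {X : Type u} [TopologicalSpace X] (F : IndSpace X)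

lemma monotone_piece : Monotone F.piece := monotone_nat_of_le_succ F.piece_subset_succ

lemma exists_mem_piece (x : X) : ∃ n, x ∈ F.piece n := by
  simpa using F.iUnion_piece.symm.subset (mem_univ x)

lemma isClosed_piece (n : ℕ) : IsClosed (F.piece n) := by
  refine F.isClosed_of_forall _ fun m => ?_
  rcases le_total m n with h | h
  · convert isClosed_univ
    exact eq_univ_of_forall fun x => F.monotone_piece h x.2
  · induction m, h using Nat.le_induction with
    | base => convert isClosed_univ; exact eq_univ_of_forall fun x => x.2
    | succ m h ih =>
      obtain ⟨C, hC, hC'⟩ := isClosed_induced_iff.1 ih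
      obtain ⟨C₁, hC₁, hC₁'⟩ := isClosed_induced_iff.1 (F.isClosed_piece_succ m)
      refine isClosed_induced_iff.2 ⟨C ∩ C₁, hC.inter hC₁, ?_⟩
      ext x
      have h1 : (x : X) ∈ C₁ ↔ (x : X) ∈ F.piece m := Set.ext_iff.1 hC₁' x
      constructor
      · rintro ⟨hx, hx₁⟩
        exact (Set.ext_iff.1 hC' ⟨x, h1.1 hx₁⟩).1 hx
      · intro hx
        have hx₁ := F.monotone_piece h hx
        exact ⟨(Set.ext_iff.1 hC' ⟨x, hx₁⟩).2 hx, h1.2 hx₁⟩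

lemma isClosed_iff {S : Set X} : IsClosed S ↔ ∀ n, IsClosed (S ∩ F.piece n) := by
  refine ⟨fun h n => h.inter (F.isClosed_piece n), fun h => F.isClosed_of_forall _ fun n => ?_⟩
  convert (h n).preimage continuous_subtype_val using 1
  ext x
  simp

/-- A compact subset of a `T₁` ind-space lies in one of its pieces. -/
lemma exists_subset_piece [T1Space X] {K : Set X} (hK : IsCompact K) : ∃ n, K ⊆ F.piece n := by
  by_contra! h
  choose x hxK hx using fun n => not_subset.1 (h n)
  -- Each tail of the sequence meets every piece in a finite set, hence is closed; the complements
  -- of the tails form an increasing open cover without a finite subcover of K.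
  have hU : ∀ n, IsOpen (x '' Ici n)ᶜ := by
    intro n
    rw [isOpen_compl_iff, F.isClosed_iff]
    intro m
    refine ((finite_lt_nat m).image x).subset ?_ |>.isClosed
    rintro _ ⟨⟨k, -, rfl⟩, hk⟩
    exact ⟨k, lt_of_not_ge fun hmk => hx k (F.monotone_piece hmk hk), rfl⟩
  obtain ⟨n, hn⟩ := hK.elim_directed_cover _ hU
    (fun y _ => by
      obtain ⟨n, hn⟩ := F.exists_mem_piece y
      refine mem_iUnion.2 ⟨n, ?_⟩
      rintro ⟨k, hk, rfl⟩
      exact hx k (F.monotone_piece hk hn))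
    (Monotone.directed_le fun a b hab => by
      gcongr)
  exact hn (hxK n) ⟨n, mem_Ici.2 le_rfl, rfl⟩

/-- A map defined on an ind-space is continuous as soon as it is continuous on every piece. -/
lemma continuous_of_continuousOn_piece {Y : Type*} [TopologicalSpace Y] {f : X → Y}
    (hf : ∀ n, ContinuousOn f (F.piece n)) : Continuous f := by
  refine continuous_iff_isClosed.2 fun Z hZ => F.isClosed_iff.2 fun n => ?_
  rw [inter_comm]
  exact (hf n).preimage_isClosed_of_isClosed (F.isClosed_piece n) hZ

variable {F} [MulAction ℂˣ X]

/-- Compact subsets of a piece are carried into any open neighborhood of a strongly attractive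
subset by all sufficiently small scalars. -/
lemma IsStronglyAttractive.exists_smul_mem {A : Set X} (hA : F.IsStronglyAttractive A) {W : Set X}
    (hW : IsOpen W) (hAW : A ⊆ W) {K : Set X} (hK : IsCompact K) {n : ℕ} (hKn : K ⊆ F.piece n) :
    ∃ s : ℝ, 0 < s ∧ ∀ t : ℂˣ, ‖(t : ℂ)‖ ≤ s → ∀ x ∈ K, t • x ∈ W := by
  refine hK.induction_on (p := fun K' => ∃ s : ℝ, 0 < s ∧ ∀ t : ℂˣ, ‖(t : ℂ)‖ ≤ s →
    ∀ x ∈ K' ∩ F.piece n, t • x ∈ W) ⟨1, one_pos, by simp⟩ ?_ ?_ ?_ |>.imp fun s hs =>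
      ⟨hs.1, fun t ht x hx => hs.2 t ht x ⟨hx, hKn hx⟩⟩
  · rintro S T hST ⟨s, hs, h⟩
    exact ⟨s, hs, fun t ht x hx => h t ht x ⟨hST hx.1, hx.2⟩⟩
  · rintro S T ⟨s, hs, h⟩ ⟨s', hs', h'⟩
    refine ⟨min s s', lt_min hs hs', fun t ht x hx => ?_⟩
    rcases hx.1 with hx1 | hx1
    · exact h t (ht.trans (min_le_left _ _)) x ⟨hx1, hx.2⟩
    · exact h' t (ht.trans (min_le_right _ _)) x ⟨hx1, hx.2⟩
  · intro x _
    obtain ⟨U, hU, h⟩ := hA.flowsTo W hW hAW x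
    obtain ⟨s, hs, h⟩ := h n
    exact ⟨U, mem_nhdsWithin_of_mem_nhds hU, s, hs, fun t ht x hx => (h t ht x hx).1⟩

/-- A positive real number as a nonzero complex number. -/
noncomputable def unitOfPos (s : Ioi (0 : ℝ)) : ℂˣ :=
  Units.mk0 ((s : ℝ) : ℂ) (Complex.ofReal_ne_zero.2 (ne_of_gt s.2))

lemma continuous_unitOfPos : Continuous unitOfPos := by
  refine Units.isEmbedding_val₀.continuous_iff.2 ?_
  exact Complex.continuous_ofReal.comp continuous_subtype_val

/-- The homotopy concatenates the flow along a real segment of scalars with the retraction of a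
regular neighborhood. Invariance of A handles the first stage, and stationarity on A the second. -/
lemma deformsCompactsInto [T1Space X] [ContinuousSMul ℂˣ X]
    (hF : ∀ (t : ℂˣ) (n : ℕ), ∀ x ∈ F.piece n, t • x ∈ F.piece n) {A : Set X}
    (hA : F.IsStronglyAttractive A)
    (hreg : ∀ n, HasRegularNeighborhood ((↑) ⁻¹' A : Set (F.piece n))) :
    DeformsCompactsInto A := by
  intro K _ _ f
  obtain ⟨n, hn⟩ := F.exists_subset_piece (isCompact_range f.continuous)
  obtain ⟨W, hW, r, hr, ⟨R⟩⟩ := hreg n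
  obtain ⟨O, hO, hAO, hOW⟩ := mem_nhdsSet_iff_exists.1 hW
  obtain ⟨V, hV, rfl⟩ := isOpen_induced_iff.1 hO
  -- V contains only the part of A in the n-th piece; adding the open complement of that piece
  -- yields a neighborhood of all of A. Invariance of the piece then rules out the added part.
  obtain ⟨s, hs, hsV⟩ := hA.exists_smul_mem (W := V ∪ (F.piece n)ᶜ)
    (hV.union (F.isClosed_piece n).isOpen_compl)
    (fun x hx => by
      by_cases h : x ∈ F.piece n
      · exact Or.inl (hAO (show (⟨x, h⟩ : F.piece n) ∈ _ from hx))
      · exact Or.inr h)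
    (isCompact_range f.continuous) hn
  have hpos : ∀ t : I, 0 < 1 - (t : ℝ) + t * s := fun t => by
    rcases t.2.1.eq_or_lt with h | h
    · simp [← h]
    · nlinarith [t.2.2, mul_pos h hs]
  -- The segment of positive reals from 1 to s.
  let c : I → ℂˣ := fun t => unitOfPos ⟨1 - t + t * s, hpos t⟩
  have hc : Continuous c := continuous_unitOfPos.comp (by fun_prop)
  have hc0 : c 0 = 1 := Units.ext (by simp [c, unitOfPos])
  have hc1 : ‖(c 1 : ℂ)‖ ≤ s := by
    simp [c, unitOfPos, abs_of_pos hs]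
  have hmem : ∀ k, c 1 • f k ∈ F.piece n := fun k => hF _ _ _ (hn ⟨k, rfl⟩)
  let w : C(K, W) := ⟨fun k => ⟨⟨c 1 • f k, hmem k⟩, hOW <|
      (hsV _ hc1 _ ⟨k, rfl⟩).resolve_right fun h => h (hmem k)⟩,
    ((f.continuous.const_smul (c 1)).subtype_mk _).subtype_mk _⟩
  have h1 : f.HomotopicWith (c 1 • f) fun h => MapsTo h (f ⁻¹' A) A :=
    ⟨⟨⟨⟨fun p => c p.1 • f p.2, by fun_prop⟩, fun k => by simp [hc0], fun k => rfl⟩,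
      fun t k hk => hA.smul_mem _ _ hk⟩⟩
  have h2 : (c 1 • f).HomotopicWith
      ⟨fun k => ((r (w k) : F.piece n) : X), by fun_prop⟩ fun h => MapsTo h (f ⁻¹' A) A := by
    refine ⟨⟨⟨⟨fun p => ((R (p.1, w p.2) : F.piece n) : X), by fun_prop⟩, fun k => ?_,
      fun k => ?_⟩, fun t k hk => ?_⟩⟩
    · change ((R (0, w k) : F.piece n) : X) = _
      rw [R.apply_zero]; rfl
    · change ((R (1, w k) : F.piece n) : X) = _
      rw [R.apply_one]; rfl
    · have hk' : c 1 • f k ∈ A := hA.smul_mem _ _ hk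
      change ((R (t, w k) : F.piece n) : X) ∈ A
      rw [R.eq_fst t (show w k ∈ _ from hk')]
      exact hk'
  exact ⟨_, fun k => hr (w k), h1.trans h2⟩

end IndSpace

/-! ### Extension of lifts over CW complexes -/

/-- The limit of a sequence of functions, each agreeing with the preceding one on a member of an
increasing exhaustion. -/
lemma exists_limit_of_eqOn {α : Type*} {β : Type*} (S : ℕ → Set α) (hS : Monotone S)
    (hU : ⋃ k, S k = univ) (P : ℕ → (α → β) → Prop) {f₀ : α → β} (h₀ : P 0 f₀)
    (step : ∀ k f, P k f → ∃ g, P (k + 1) g ∧ EqOn g f (S k)) :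
    ∃ f : α → β, EqOn f f₀ (S 0) ∧ ∀ k, ∃ g, P k g ∧ EqOn f g (S k) := by
  classical
  choose! ext hext hagree using step
  let g : ℕ → α → β := fun k => Nat.rec f₀ (fun k f => ext k f) k
  have hg : ∀ k, P k (g k) := fun k => by
    induction k with
    | zero => exact h₀
    | succ k ih => exact hext k _ ih
  have hgg : ∀ k m, k ≤ m → EqOn (g m) (g k) (S k) := fun k m hkm => by
    induction m, hkm using Nat.le_induction with
    | base => exact eqOn_refl _ _
    | succ m hkm ih => exact ((hagree m _ (hg m)).mono (hS hkm)).trans ih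
  have hex : ∀ x, ∃ k, x ∈ S k := fun x => by simpa using hU.symm.subset (mem_univ x)
  have hlim : ∀ k, EqOn (fun x => g (Nat.find (hex x)) x) (g k) (S k) := fun k x hx =>
    (hgg _ _ (Nat.find_min' (hex x) hx) (Nat.find_spec (hex x))).symm
  exact ⟨fun x => g (Nat.find (hex x)) x, hlim 0, fun k => ⟨g k, hg k, hlim k⟩⟩

/-- The right lifting property of `p : P → Z` with respect to the inclusions of spheres in balls. -/
def LiftsDisks {P : Type*} {Z : Type*} [TopologicalSpace P] [TopologicalSpace Z] (p : P → Z) :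
    Prop :=
  ∀ (k : ℕ) (f : (Fin k → ℝ) → Z) (l : (Fin k → ℝ) → P), ContinuousOn f (closedBall 0 1) →
    ContinuousOn l (sphere 0 1) → (∀ x ∈ sphere 0 1, p (l x) = f x) →
    ∃ L : (Fin k → ℝ) → P, ContinuousOn L (closedBall 0 1) ∧ EqOn L l (sphere 0 1) ∧
      ∀ x ∈ closedBall 0 1, p (L x) = f x

/-! ### Lifts over a single CW complex -/

section CW

open RelCWComplex

variable {Y : Type u} [TopologicalSpace Y] [T2Space Y] [CWComplex (univ : Set Y)]
  {P : Type*} {Z : Type*} [TopologicalSpace P] [TopologicalSpace Z]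

/-- The characteristic map sends closed subsets of the ball to compact, hence closed, sets, so it is
a quotient map onto the closed cell. -/
lemma continuousOn_closedCell {n : ℕ} {e : cell (univ : Set Y) n} {f : Y → P}
    (hf : ContinuousOn (f ∘ map n e) (closedBall 0 1)) : ContinuousOn f (closedCell n e) := by
  refine continuousOn_iff_isClosed.2 fun T hT => ?_
  obtain ⟨u, hu, hu'⟩ := continuousOn_iff_isClosed.1 hf T hT
  refine ⟨map n e '' (u ∩ closedBall 0 1), ?_, ?_⟩
  · refine IsCompact.isClosed (IsCompact.image_of_continuousOn ?_ ?_)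
    · exact (isCompact_closedBall _ _).inter_left hu
    · exact (RelCWComplex.continuousOn n e).mono inter_subset_right
  · rw [← hu', preimage_comp, image_preimage_inter]
    simp only [closedCell, inter_assoc, inter_self]

lemma continuous_of_continuousOn_closedCell {f : Y → P}
    (hf : ∀ (n : ℕ) (e : cell (univ : Set Y) n), ContinuousOn f (closedCell n e)) :
    Continuous f := by
  refine continuous_iff_isClosed.2 fun T hT => ?_
  rw [CWComplex.closed (univ : Set Y) _ (subset_univ _)]
  intro n e
  rw [inter_comm]
  exact (hf n e).preimage_isClosed_of_isClosed isClosed_closedCell hT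

/-- The frontier is covered by finitely many closed cells of lower dimension, and continuity glues
over finite closed covers. -/
lemma continuousOn_cellFrontier {n : ℕ} (e : cell (univ : Set Y) n) {f : Y → P}
    (hf : ∀ m < n, ∀ e' : cell (univ : Set Y) m, ContinuousOn f (closedCell m e')) :
    ContinuousOn f (cellFrontier n e) := by
  obtain ⟨J, hJ⟩ := CWComplex.cellFrontier_subset_finite_closedCell n e
  refine ContinuousOn.mono ?_ hJ
  refine continuousOn_iff_isClosed.2 fun T hT =>
    ⟨⋃ m ∈ Iio n, ⋃ j ∈ J m, closedCell m j ∩ f ⁻¹' T, ?_, ?_⟩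
  · exact (finite_Iio n).isClosed_biUnion fun m hm => (J m).finite_toSet.isClosed_biUnion
      fun j _ => (hf m hm j).preimage_isClosed_of_isClosed isClosed_closedCell hT
  · ext y
    simp only [mem_inter_iff, mem_iUnion, mem_Iio, mem_preimage]
    grind

/-- Extension of a lift from a union of cells to the next skeleton. -/
lemma exists_extend_lift_succ {p : P → Z} (hp : LiftsDisks p) {f : Y → Z} (hf : Continuous f)
    {B : Set Y}
    (hB : ∀ (n : ℕ) (e : cell (univ : Set Y) n), closedCell n e ⊆ B ∨ Disjoint (openCell n e) B)
    (k : ℕ) (s : Y → P) (hs : ∀ y ∈ B ∪ skeletonLT (univ : Set Y) k, p (s y) = f y)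
    (hsB : ContinuousOn s B)
    (hsc : ∀ m < k, ∀ e : cell (univ : Set Y) m, ContinuousOn s (closedCell m e)) :
    ∃ t : Y → P, ((∀ y ∈ B ∪ skeletonLT (univ : Set Y) (k + 1 : ℕ), p (t y) = f y) ∧
      ContinuousOn t B ∧
      ∀ m < k + 1, ∀ e : cell (univ : Set Y) m, ContinuousOn t (closedCell m e)) ∧
      EqOn t s (B ∪ skeletonLT (univ : Set Y) k) := by
  classical
  have hfrontier : ∀ (e : cell (univ : Set Y) k), ∀ x ∈ sphere (0 : Fin k → ℝ) 1,
      map k e x ∈ B ∪ skeletonLT (univ : Set Y) k := fun e x hx =>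
    Or.inr (cellFrontier_subset_skeletonLT k e (mem_image_of_mem _ hx))
  have hL : ∀ e : cell (univ : Set Y) k, ∃ L : (Fin k → ℝ) → P, ContinuousOn L (closedBall 0 1) ∧
      EqOn L (s ∘ map k e) (sphere 0 1) ∧ ∀ x ∈ closedBall 0 1, p (L x) = f (map k e x) := fun e =>
    hp k (f ∘ map k e) (s ∘ map k e) (hf.comp_continuousOn (RelCWComplex.continuousOn k e))
      ((continuousOn_cellFrontier e hsc).comp
        ((RelCWComplex.continuousOn k e).mono sphere_subset_closedBall) (mapsTo_image _ _))
      fun x hx => hs _ (hfrontier e x hx)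
  choose L hLc hLs hLp using hL
  -- Only open k-cells off B receive new values, transported by the inverse of the characteristic
  -- map; elsewhere s is kept.
  let t : Y → P := fun y =>
    if h : ∃ e : cell (univ : Set Y) k, y ∈ openCell k e ∧ Disjoint (openCell k e) B then
      L h.choose ((map k h.choose).symm y)
    else s y
  have hts : EqOn t s (B ∪ skeletonLT (univ : Set Y) k) := by
    intro y hy
    refine dif_neg ?_
    rintro ⟨e, hye, heB⟩
    rcases hy with hy | hy
    · exact disjoint_left.1 heB hye hy
    · exact disjoint_left.1 (disjoint_skeletonLT_openCell le_rfl) hy hye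
  -- On the sphere both sides equal s; in the open ball, disjointness of distinct open cells forces
  -- the chosen cell to be e.
  have hto : ∀ e : cell (univ : Set Y) k, Disjoint (openCell k e) B →
      EqOn (t ∘ map k e) (L e) (closedBall 0 1) := by
    intro e he x hx
    rw [← sphere_union_ball] at hx
    rcases hx with hx | hx
    · exact (hts (hfrontier e x hx)).trans (hLs e hx).symm
    · have hmem : map k e x ∈ openCell k e := mem_image_of_mem _ hx
      have h : ∃ e' : cell (univ : Set Y) k,
          map k e x ∈ openCell k e' ∧ Disjoint (openCell k e') B := ⟨e, hmem, he⟩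
      have hch : h.choose = e := by
        by_contra hne
        exact disjoint_left.1 (disjoint_openCell_of_ne (fun heq => hne (by simpa using heq)))
          h.choose_spec.1 hmem
      change dite _ _ _ = _
      rw [dif_pos h, hch, (map k e).left_inv (by rwa [source_eq])]
  refine ⟨t, ⟨?_, hsB.congr (hts.mono subset_union_left), ?_⟩, hts⟩
  · intro y hy
    by_cases hy' : y ∈ B ∪ skeletonLT (univ : Set Y) k
    · rw [hts hy', hs y hy']
    · have hy1 : y ∈ (skeletonLT (univ : Set Y) (k + 1 : ℕ) : Set Y) :=
        hy.resolve_left fun h => hy' (Or.inl h)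
      rw [Nat.cast_add, Nat.cast_one, ← skeletonLT_union_iUnion_closedCell_eq_skeletonLT_succ] at hy1
      obtain ⟨e, hye⟩ := mem_iUnion.1 (hy1.resolve_left fun h => hy' (Or.inr h))
      rcases hB k e with he | he
      · exact absurd (Or.inl (he hye)) hy'
      · obtain ⟨x, hx, rfl⟩ := hye
        exact (congrArg p (hto e he hx)).trans (hLp e x hx)
  · intro m hm e
    rcases Nat.lt_succ_iff_lt_or_eq.1 hm with hm | rfl
    · refine (hsc m hm e).congr (hts.mono (subset_union_of_subset_right ?_ _))
      refine (closedCell_subset_skeletonLT m e).trans (skeletonLT_mono ?_)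
      exact_mod_cast hm
    · rcases hB m e with he | he
      · exact (hsB.mono he).congr (hts.mono (subset_union_of_subset_left he _))
      · exact continuousOn_closedCell ((hLc e).congr (hto e he))

/-- Extension of a lift from a union of cells to the whole CW complex. -/
lemma exists_extend_lift {p : P → Z} (hp : LiftsDisks p) {f : Y → Z} (hf : Continuous f)
    {B : Set Y}
    (hB : ∀ (n : ℕ) (e : cell (univ : Set Y) n), closedCell n e ⊆ B ∨ Disjoint (openCell n e) B)
    {s : Y → P} (hs : ∀ y ∈ B, p (s y) = f y) (hsB : ContinuousOn s B) :
    ∃ t : Y → P, Continuous t ∧ (∀ y, p (t y) = f y) ∧ EqOn t s B := by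
  have hU : ⋃ k : ℕ, B ∪ (skeletonLT (univ : Set Y) k : Set Y) = univ := by
    rw [← union_iUnion, iUnion_skeletonLT_eq_complex, union_univ]
  obtain ⟨t, ht0, ht⟩ := exists_limit_of_eqOn
    (fun k : ℕ => B ∪ (skeletonLT (univ : Set Y) k : Set Y))
    (fun k m h => union_subset_union_right _ (skeletonLT_mono (by exact_mod_cast h))) hU
    (fun k t => (∀ y ∈ B ∪ skeletonLT (univ : Set Y) k, p (t y) = f y) ∧ ContinuousOn t B ∧
      ∀ m < k, ∀ e : cell (univ : Set Y) m, ContinuousOn t (closedCell m e)) (f₀ := s)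
    (by
      refine ⟨fun y hy => hs y ?_, hsB, fun m hm => absurd hm m.not_lt_zero⟩
      simpa [CWComplex.skeletonLT_zero_eq_empty] using hy)
    (fun k t ht => exists_extend_lift_succ hp hf hB k t ht.1 ht.2.1 ht.2.2)
  refine ⟨t, continuous_of_continuousOn_closedCell fun n e => ?_, fun y => ?_,
    ht0.mono subset_union_left⟩
  · obtain ⟨g, hg, htg⟩ := ht (n + 1)
    exact (hg.2.2 n n.lt_succ_self e).congr (htg.mono (subset_union_of_subset_right
      (by exact_mod_cast closedCell_subset_skeletonLT n e) _))
  · obtain ⟨k, hk⟩ := mem_iUnion.1 (hU.symm.subset (mem_univ y))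
    obtain ⟨g, hg, htg⟩ := ht k
    rw [htg hk, hg.1 y hk]

lemma subcomplex_closedCell_subset_or_disjoint (E : Subcomplex (univ : Set Y)) (n : ℕ)
    (e : cell (univ : Set Y) n) :
    closedCell n e ⊆ (E : Set Y) ∨ Disjoint (openCell n e) (E : Set Y) := by
  by_cases h : e ∈ E.I n
  · exact Or.inl (E.closedCell_subset_of_mem h)
  · exact Or.inr (E.disjoint_openCell_subcomplex_of_not_mem h)

end CW

/-! ### Deformation retractions of ind-CW pairs -/

/-- A lift to this path space is a family of paths ending in A, so `exists_extension` supplies the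
lifting property. -/
lemma DeformsCompactsInto.liftsDisks {X : Type u} [TopologicalSpace X] {A : Set X}
    (hA : DeformsCompactsInto A) : LiftsDisks fun γ : {γ : C(I, X) | γ 1 ∈ A} => γ.1 0 := by
  classical
  intro k f l hf hl hlf
  obtain ⟨L, hL, hLl, hLf⟩ := hA.exists_extension (l := fun x => (l x).1) hf
    (continuous_subtype_val.comp_continuousOn hl) fun x hx => ⟨hlf x hx, (l x).2⟩
  -- The default `l x` is never used on the closed ball.
  let L' : (Fin k → ℝ) → {γ : C(I, X) | γ 1 ∈ A} := fun x =>
    if h : L x 1 ∈ A then ⟨L x, h⟩ else l x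
  have hL' : ∀ x ∈ closedBall 0 1, (L' x).1 = L x := fun x hx => by
    simp only [L', dif_pos (hLf x hx).2]
  refine ⟨L', ?_, fun x hx => Subtype.ext ?_, fun x hx => ?_⟩
  · exact IsInducing.subtypeVal.continuousOn_iff.2 (hL.congr hL')
  · rw [hL' x (sphere_subset_closedBall hx), hLl hx]
  · exact (congrArg (fun γ : C(I, X) => γ 0) (hL' x hx)).trans (hLf x hx).1

namespace IndSpace

variable {X : Type u} [TopologicalSpace X] {F : IndSpace X}

open RelCWComplex

lemma exists_extend_lift_piece {P : Type*} [TopologicalSpace P] {p : P → X} (hp : LiftsDisks p)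
    {n : ℕ} [T2Space (F.piece n)] [CWComplex (univ : Set (F.piece n))] {B : Set X}
    (hB : ∀ (k : ℕ) (e : cell (univ : Set (F.piece n)) k),
      closedCell k e ⊆ ((↑) ⁻¹' B : Set (F.piece n)) ∨
        Disjoint (openCell k e) ((↑) ⁻¹' B : Set (F.piece n)))
    {s : X → P} (hs : ∀ x ∈ B, p (s x) = x) (hsB : ContinuousOn s B) :
    ∃ t : X → P, ContinuousOn t (F.piece n) ∧ (∀ x ∈ F.piece n, p (t x) = x) ∧ EqOn t s B := by
  classical
  obtain ⟨t, ht, htp, hts⟩ := exists_extend_lift hp (continuous_subtype_val (p := (· ∈ F.piece n)))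
    hB (s := fun x => s x) (fun x hx => hs x hx)
    (hsB.comp continuous_subtype_val.continuousOn fun _ hx => hx)
  -- B need not lie in the piece; the default s preserves agreement on the rest of B.
  let t' : X → P := fun x => if h : x ∈ F.piece n then t ⟨x, h⟩ else s x
  have ht' : ∀ x : F.piece n, t' x = t x := fun x => dif_pos x.2
  refine ⟨t', ?_, fun x hx => ?_, fun x hx => ?_⟩
  · rw [continuousOn_iff_continuous_domRestrict]
    exact ht.congr fun x => (ht' x).symm
  · rw [ht' ⟨x, hx⟩, htp]
  · by_cases h : x ∈ F.piece n
    · exact (ht' ⟨x, h⟩).trans (hts (show (⟨x, h⟩ : F.piece n) ∈ _ from hx))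
    · exact dif_neg h

/-- A lift of the identity over `A` extends over `X` if `(X, A)` is an ind-CW pair. -/
lemma IsIndCWPair.exists_extend_lift {A : Set X} (hFA : F.IsIndCWPair A) (hAc : IsClosed A)
    {P : Type*} [TopologicalSpace P] {p : P → X} (hp : LiftsDisks p) {s : X → P}
    (hs : ∀ x ∈ A, p (s x) = x) (hsA : ContinuousOn s A) :
    ∃ t : X → P, Continuous t ∧ (∀ x, p (t x) = x) ∧ EqOn t s A := by
  obtain ⟨hT2, ⟨_, E, hE⟩, hsucc⟩ := hFA
  obtain ⟨s₀, hs₀, hs₀p, hs₀A⟩ := exists_extend_lift_piece (F := F) (n := 0) hp (B := A)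
    (fun k e => hE ▸ subcomplex_closedCell_subset_or_disjoint E k e) hs hsA
  have hU : ⋃ n, A ∪ F.piece n = univ := by
    rw [← union_iUnion, F.iUnion_piece, union_univ]
  obtain ⟨t, ht0, ht⟩ := exists_limit_of_eqOn (fun n => A ∪ F.piece n)
    (fun n m h => union_subset_union_right _ (F.monotone_piece h)) hU
    (fun n t => ContinuousOn t (F.piece n) ∧ (∀ x ∈ F.piece n, p (t x) = x) ∧ EqOn t s A)
    (f₀ := s₀) ⟨hs₀, hs₀p, hs₀A⟩ (by
      rintro n t ⟨ht, htp, hts⟩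
      obtain ⟨_, E, E', hE, hE'⟩ := hsucc n
      obtain ⟨t', ht', htp', htt⟩ := exists_extend_lift_piece (F := F) (n := n + 1) hp
        (B := A ∪ F.piece n) (s := t) (fun k e => by
          rw [preimage_union, ← hE, ← hE', disjoint_union_right]
          rcases subcomplex_closedCell_subset_or_disjoint E k e with h | h
          · exact Or.inl (subset_union_of_subset_left h _)
          rcases subcomplex_closedCell_subset_or_disjoint E' k e with h' | h'
          · exact Or.inl (subset_union_of_subset_right h' _)
          · exact Or.inr ⟨h, h'⟩)
        (by
          rintro x (hx | hx)
          · rw [hts hx, hs x hx]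
          · exact htp x hx)
        -- A and the n-th piece are closed, so continuity on each gives continuity on the union; no
        -- CW structure on the n-th piece enters.
        ((hsA.congr hts).union_of_isClosed ht hAc (F.isClosed_piece n))
      exact ⟨t', ⟨ht', htp', (htt.mono subset_union_left).trans hts⟩, htt⟩)
  refine ⟨t, F.continuous_of_continuousOn_piece fun n => ?_, fun x => ?_,
    (ht0.mono subset_union_left).trans hs₀A⟩
  · obtain ⟨g, hg, htg⟩ := ht n
    exact hg.1.congr (htg.mono subset_union_right)
  · obtain ⟨n, hn⟩ := F.exists_mem_piece x
    obtain ⟨g, hg, htg⟩ := ht n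
    rw [htg (Or.inr hn), hg.2.1 x hn]

/-- A continuous section of p assigns to each point a path from it into A; by currying this is a
homotopy, stationary on A because the paths there are constant. -/
lemma IsIndCWPair.isDeformationRetract {A : Set X} (hFA : F.IsIndCWPair A) (hAc : IsClosed A)
    (hA : DeformsCompactsInto A) : IsDeformationRetract A := by
  classical
  have hne : ∀ _ : X, ∃ a, a ∈ A := fun x =>
    let ⟨g, hg, _⟩ := hA PUnit (ContinuousMap.const _ x)
    ⟨g PUnit.unit, hg _⟩
  choose a ha using hne
  -- The section must be a total function into paths ending in A; its values off A are arbitrary.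
  let b : X → X := fun x => if x ∈ A then x else a x
  have hb : ∀ x, b x ∈ A := fun x => by
    by_cases h : x ∈ A
    · simp [b, h]
    · simp [b, h, ha]
  have hbA : EqOn b id A := fun x hx => if_pos hx
  obtain ⟨t, ht, ht0, hts⟩ := hFA.exists_extend_lift hAc hA.liftsDisks
    (s := fun x => ⟨ContinuousMap.const I (b x), hb x⟩) (fun x hx => hbA hx)
    (IsInducing.subtypeVal.continuousOn_iff.2
      (ContinuousMap.continuous_const'.comp_continuousOn (continuousOn_id.congr hbA)))
  have htc : Continuous fun x => (t x).1 := continuous_subtype_val.comp ht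
  refine ⟨⟨fun x => (t x).1 1, (continuous_eval_const (F := C(I, X)) 1).comp htc⟩,
    fun x => (t x).2, ⟨⟨⟨⟨fun q => (t q.2).1 q.1, by fun_prop⟩, ht0, fun _ => rfl⟩, ?_⟩⟩⟩
  intro τ x hx
  change (t x).1 τ = x
  rw [hts hx]
  exact hbA hx

end IndSpace

theorem theorem3p4 {X : Type u} [TopologicalSpace X] [T1Space X] (F : IndSpace X)
    [MulAction ℂˣ X] [ContinuousSMul ℂˣ X]
    (hF : ∀ (t : ℂˣ) (n : ℕ), ∀ x ∈ F.piece n, t • x ∈ F.piece n)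
    (A : Set X) (hA : F.IsStronglyAttractive A)
    (hreg : ∀ n, HasRegularNeighborhood ((↑) ⁻¹' A : Set (F.piece n))) :
    IsWeakEquivalence (⟨Subtype.val, continuous_subtype_val⟩ : C(A, X)) ∧
      (F.IsIndCWPair A → IsDeformationRetract A) :=
  have h := IndSpace.deformsCompactsInto hF hA hreg
  ⟨h.isWeakEquivalence, fun hCW => hCW.isDeformationRetract hA.isClosed h⟩
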